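/- Let $K$ be a field of characteristic $0$, let $S=K[x_1,\dots,x_l]$ with the standard grading, and let $I$ be a homogeneous ideal of $S$. A graded $K$-algebra $R=\bigoplus_{i\ge 0}R_i$ with finite-dimensional components has the weak Lefschetz property (WLP) if there is $\ell\in R_1$ such that the multiplication map $\times\ell\colon R_i\to R_{i+1}$ has full rank (that is, is injective or surjective) for every $i\ge 0$. Let $\beta_{i,j}(I)$ be the graded Betti numbers of $I$, that is, the number of summands $S(-j)$ in homological degree $i$ of a minimal graded free resolution of $I$, and let $$\operatorname{reg}(I)=\max\{\,j-i \mid \beta_{i,j}(I)\neq 0\,\}$$ be the Castelnuovo--Mumford regularity of $I$ (for $I=0$ put $\operatorname{reg}(I)=0$). For $I\neq 0$ this maximum exists, so that only finitely many $i\geq 0$ satisfy $i\le\operatorname{reg}(I)-1$, and the following are equivalent for every homogeneous ideal $I$: 1. the graded ring $S/I$ has the WLP; 2. there exists $\ell\in(S/I)_1$ such that the multiplication map $\times\ell\colon(S/I)_i\to(S/I)_{i+1}$ has full rank for every $0\le i\le\operatorname{reg}(I)-1$. -/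

import Mathlib

/-!
Suppose that a general linear form kills a nonzero element of `(S/I)_i`. By prime avoidance some
multiple of that element spans a copy of the residue field, so `S/I` has a nonzero socle element of
a degree `j ≥ i`. A socle element of degree `j` forces a summand `S(-j-l)` in homological degree
`l - 1` of every graded free resolution of `I`: modulo `x_0` it becomes a socle element of degree
`j + 1` of the module of first syzygies, and induction on `l` applies. Hence `i ≤ j < reg I`, that
is, a general linear form acts injectively in all degrees `i ≥ reg I`. In the finitely many degrees
below `reg I`, full rank of `ℓ₀` is inherited by `ℓ₀ + s ℓ₁` for all but finitely many scalars `s`.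
-/

attribute [local instance] MvPolynomial.gradedAlgebra

namespace Lefschetz

section GradedRing

variable {K R : Type*} [Field K] [CommRing R] [Algebra K R]

/-- Multiplication by a degree-one element `ℓ`, as a `K`-linear map `R_i → R_{i+1}`. -/
def mulMap (𝒜 : ℕ → Submodule K R) [SetLike.GradedMonoid 𝒜] (ℓ : 𝒜 1) (i : ℕ) :
    𝒜 i →ₗ[K] 𝒜 (i + 1) :=
  (LinearMap.mulLeft K (ℓ : R)).restrict fun x hx => by
    have h := SetLike.mul_mem_graded (A := 𝒜) ℓ.2 hx
    rwa [add_comm] at h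

/-- A linear map has full rank if it is injective or surjective. Between finite-dimensional
spaces this says that its rank is the smaller one of the two dimensions. -/
def FullRank {V W : Type*} [AddCommGroup V] [Module K V] [AddCommGroup W] [Module K W]
    (f : V →ₗ[K] W) : Prop :=
  Function.Injective f ∨ Function.Surjective f

/-- The weak Lefschetz property of a graded ring `R = ⨁ 𝒜 i` over `K`. -/
def HasWLP (𝒜 : ℕ → Submodule K R) [SetLike.GradedMonoid 𝒜] : Prop :=
  ∃ ℓ : 𝒜 1, ∀ i : ℕ, FullRank (mulMap 𝒜 ℓ i)

end GradedRing

section Polynomial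

variable {K : Type*} [Field K] {l : ℕ}

/-- The homogeneous component `(S/I)_i` of `S/I`, where `S = K[x_1, …, x_l]`: the image of the
space of forms of degree `i`. -/
noncomputable def quotientGrading (I : Ideal (MvPolynomial (Fin l) K)) (i : ℕ) :
    Submodule K (MvPolynomial (Fin l) K ⧸ I) :=
  (MvPolynomial.homogeneousSubmodule (Fin l) K i).map (Ideal.Quotient.mkₐ K I).toLinearMap

instance quotientGrading.gradedMonoid (I : Ideal (MvPolynomial (Fin l) K)) :
    SetLike.GradedMonoid (quotientGrading I) where
  one_mem := ⟨1, MvPolynomial.isHomogeneous_one _ _, map_one (Ideal.Quotient.mkₐ K I)⟩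
  mul_mem := by
    rintro i j _ _ ⟨f, hf, rfl⟩ ⟨g, hg, rfl⟩
    exact ⟨f * g, MvPolynomial.IsHomogeneous.mul hf hg, map_mul (Ideal.Quotient.mkₐ K I) f g⟩

/-- A minimal graded free resolution `⋯ → F_2 → F_1 → F_0 → I → 0` of an ideal `I` of
`S = K[x_1, …, x_l]`, in coordinates: `F_i = ⨁_k S(-deg i k)`, with `k < rank i`. The map
`F_{i+1} → F_i` is given by the matrix `d i`, and `F_0 → I` sends the `k`-th basis vector to
`gen k`. -/
structure MinimalGradedFreeResolution (I : Ideal (MvPolynomial (Fin l) K)) where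
  rank : ℕ → ℕ
  deg : (i : ℕ) → Fin (rank i) → ℕ
  gen : Fin (rank 0) → MvPolynomial (Fin l) K
  d : (i : ℕ) → Matrix (Fin (rank i)) (Fin (rank (i + 1))) (MvPolynomial (Fin l) K)
  /-- The augmentation `F_0 → I` is homogeneous of degree `0`. -/
  gen_homogeneous : ∀ k, (gen k).IsHomogeneous (deg 0 k)
  /-- The maps `F_{i+1} → F_i` are homogeneous of degree `0`. -/
  d_homogeneous : ∀ i r c, d i r c = 0 ∨
    ∃ n, deg i r + n = deg (i + 1) c ∧ (d i r c).IsHomogeneous n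
  /-- Exactness at `I`. -/
  span_gen : Ideal.span (Set.range gen) = I
  /-- Exactness at `F_0`. -/
  exact_zero : Function.Exact (d 0).mulVecLin
    (Fintype.linearCombination (MvPolynomial (Fin l) K) gen)
  /-- Exactness at `F_{i+1}`. -/
  exact_succ : ∀ i, Function.Exact (d (i + 1)).mulVecLin (d i).mulVecLin
  /-- Minimality: the entries of the matrices lie in the ideal `(x_1, …, x_l)`. -/
  minimal : ∀ i r c, MvPolynomial.constantCoeff (d i r c) = 0

open Classical in
/-- The graded Betti number `β_{i,j}(I)`: the number of summands `S(-j)` of `F_i` in a minimal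
graded free resolution of `I`. Every homogeneous ideal has such a resolution, and any two of them
are isomorphic. -/
noncomputable def gradedBetti (I : Ideal (MvPolynomial (Fin l) K)) (i j : ℕ) : ℕ :=
  if h : Nonempty (MinimalGradedFreeResolution I) then
    (Finset.univ.filter fun k : Fin (h.some.rank i) => h.some.deg i k = j).card
  else 0

/-- The numbers `j - i` with `β_{i,j}(I) ≠ 0`. -/
def regularitySet (I : Ideal (MvPolynomial (Fin l) K)) : Set ℤ :=
  {r | ∃ i j : ℕ, gradedBetti I i j ≠ 0 ∧ r = (j : ℤ) - (i : ℤ)}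

/-- The Castelnuovo–Mumford regularity of `I`, the largest `j - i` with `β_{i,j}(I) ≠ 0`. For
`I = 0` there are no such numbers, and the value is `0`. -/
noncomputable def regularity (I : Ideal (MvPolynomial (Fin l) K)) : ℤ :=
  sSup (regularitySet I)

end Polynomial

end Lefschetz

namespace Lefschetz

open Filter MvPolynomial
open scoped Matrix

section Perturbation

variable {K V W : Type*} [Field K] [AddCommGroup V] [Module K V] [AddCommGroup W] [Module K W]

theorem eventually_isUnit_one_add_smul {A : Type*} [Ring A] [Algebra K A] {a : A}
    (ha : (spectrum K a).Finite) : ∀ᶠ s : K in cofinite, IsUnit (1 + s • a) := by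
  have hinj : Function.Injective fun s : K => -s⁻¹ := neg_injective.comp inv_injective
  have hspec : ∀ᶠ s : K in cofinite, -s⁻¹ ∉ spectrum K a :=
    hinj.tendsto_cofinite.eventually ha.eventually_cofinite_notMem
  filter_upwards [hspec, eventually_cofinite_ne 0] with s hs hs0
  have hfactor : 1 + s • a = (-s) • (algebraMap K A (-s⁻¹) - a) := by
    rw [smul_sub, Algebra.algebraMap_eq_smul_one, smul_smul, neg_mul_neg, mul_inv_cancel₀ hs0,
      one_smul, neg_smul, sub_neg_eq_add]
  rw [hfactor]
  exact (spectrum.notMem_iff.1 hs).smul (Units.mk0 (-s) (neg_ne_zero.2 hs0))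

theorem eventually_injective_add_smul [FiniteDimensional K V] {f : V →ₗ[K] W}
    (hf : Function.Injective f) (g : V →ₗ[K] W) :
    ∀ᶠ s : K in cofinite, Function.Injective (f + s • g) := by
  obtain ⟨h, hhf⟩ := f.exists_leftInverse_of_injective (LinearMap.ker_eq_bot.2 hf)
  filter_upwards [eventually_isUnit_one_add_smul (Module.End.finite_spectrum (h ∘ₗ g))] with s hs
  have hcomp : h ∘ₗ (f + s • g) = 1 + s • (h ∘ₗ g) := by
    rw [LinearMap.comp_add, LinearMap.comp_smul, hhf, Module.End.one_eq_id]
  rw [← hcomp, Module.End.isUnit_iff, LinearMap.coe_comp] at hs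
  exact hs.1.of_comp

theorem eventually_surjective_add_smul [FiniteDimensional K W] {f : V →ₗ[K] W}
    (hf : Function.Surjective f) (g : V →ₗ[K] W) :
    ∀ᶠ s : K in cofinite, Function.Surjective (f + s • g) := by
  obtain ⟨h, hfh⟩ := f.exists_rightInverse_of_surjective (LinearMap.range_eq_top.2 hf)
  filter_upwards [eventually_isUnit_one_add_smul (Module.End.finite_spectrum (g ∘ₗ h))] with s hs
  have hcomp : (f + s • g) ∘ₗ h = 1 + s • (g ∘ₗ h) := by
    rw [LinearMap.add_comp, LinearMap.smul_comp, hfh, Module.End.one_eq_id]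
  rw [← hcomp, Module.End.isUnit_iff, LinearMap.coe_comp] at hs
  exact hs.2.of_comp

theorem FullRank.eventually_add_smul [FiniteDimensional K V] [FiniteDimensional K W]
    {f : V →ₗ[K] W} (hf : FullRank f) (g : V →ₗ[K] W) :
    ∀ᶠ s : K in cofinite, FullRank (f + s • g) :=
  hf.elim (fun hf => (eventually_injective_add_smul hf g).mono fun _ => Or.inl)
    fun hf => (eventually_surjective_add_smul hf g).mono fun _ => Or.inr

theorem eventually_add_smul_notMem {p : Submodule K V} (x : V) {y : V} (hy : y ∉ p) :
    ∀ᶠ s : K in cofinite, x + s • y ∉ p := by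
  refine Set.Subsingleton.finite fun s hs t ht => ?_
  by_contra hst
  have hdiff : (s - t) • y ∈ p := by
    have := p.sub_mem (not_not.1 hs) (not_not.1 ht)
    rwa [add_sub_add_left_eq_sub, ← sub_smul] at this
  exact hy ((p.smul_mem_iff (sub_ne_zero.2 hst)).1 hdiff)

end Perturbation

section RegularQuotient

/-- The ring homomorphism `φ : R → S` presents `S` as the quotient of `R` by the regular
element `x`. -/
structure IsRegularQuotient {R S : Type*} [CommRing R] [CommRing S] (φ : R →+* S) (x : R) :
    Prop where
  surjective : Function.Surjective φ
  ker_eq : RingHom.ker φ = Ideal.span {x}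
  isRegular : IsRegular x

namespace IsRegularQuotient

variable {R S : Type*} [CommRing R] [CommRing S] {φ : R →+* S} {x : R}
variable {ι κ μ ν : Type*}

theorem smul_injective (h : IsRegularQuotient φ x) :
    Function.Injective fun v : ι → R => x • v :=
  IsSMulRegular.pi fun _ => h.isRegular.left.isSMulRegular

theorem comp_eq_zero_iff (h : IsRegularQuotient φ x) {v : ι → R} :
    φ ∘ v = 0 ↔ ∃ w, v = x • w := by
  have hdvd (r : R) : φ r = 0 ↔ ∃ s, r = x * s := by
    rw [← RingHom.mem_ker, h.ker_eq, Ideal.mem_span_singleton, Dvd.dvd]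
    rfl
  simp only [funext_iff, Function.comp_apply, Pi.zero_apply, hdvd, Pi.smul_apply, smul_eq_mul]
  exact Classical.skolem

variable [Fintype μ]

theorem comp_mem_range_map_iff (h : IsRegularQuotient φ x) {B : Matrix κ μ R} {v : κ → R} :
    φ ∘ v ∈ LinearMap.range (B.map φ).mulVecLin ↔
      ∃ z, v - x • z ∈ LinearMap.range B.mulVecLin := by
  have hlift (w : μ → R) : (B.map φ) *ᵥ (φ ∘ w) = φ ∘ v ↔ ∃ z, v - x • z = B *ᵥ w := by
    have hsub : φ ∘ (v - B *ᵥ w) = φ ∘ v - (B.map φ) *ᵥ (φ ∘ w) := by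
      ext i
      simp [RingHom.map_mulVec]
    rw [eq_comm, ← sub_eq_zero, ← hsub, h.comp_eq_zero_iff]
    exact exists_congr fun z => sub_eq_iff_eq_add'.trans sub_eq_iff_eq_add.symm
  rw [LinearMap.mem_range, (h.surjective.comp_left (α := μ)).exists]
  simp only [Matrix.mulVecLin_apply, hlift, LinearMap.mem_range, eq_comm (a := _ - _)]
  exact exists_comm

variable [Fintype κ]

/-- The isomorphism between the annihilator of `x` in the cokernel of `A` and the homology of the
complex modulo `x`. -/
theorem comp_mem_range_map_iff_of_smul_eq (h : IsRegularQuotient φ x) {A : Matrix ι κ R}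
    {B : Matrix κ μ R} (hAB : Function.Exact B.mulVecLin A.mulVecLin) {u : ι → R} {v : κ → R}
    (hv : A.mulVecLin v = x • u) :
    φ ∘ v ∈ LinearMap.range (B.map φ).mulVecLin ↔ u ∈ LinearMap.range A.mulVecLin := by
  rw [h.comp_mem_range_map_iff, LinearMap.mem_range]
  refine exists_congr fun z => ?_
  rw [← hAB.linearMap_ker_eq, LinearMap.mem_ker, map_sub, map_smul, hv, sub_eq_zero, eq_comm]
  exact h.smul_injective.eq_iff

theorem exact_map [Fintype ν] (h : IsRegularQuotient φ x) {A : Matrix ι κ R} {B : Matrix κ μ R}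
    {C : Matrix μ ν R} (hAB : Function.Exact B.mulVecLin A.mulVecLin)
    (hBC : Function.Exact C.mulVecLin B.mulVecLin) :
    Function.Exact (C.map φ).mulVecLin (B.map φ).mulVecLin := by
  intro v
  obtain ⟨v, rfl⟩ := h.surjective.comp_left v
  have hker : (B.map φ).mulVecLin (φ ∘ v) = 0 ↔ ∃ g, B.mulVecLin v = x • g := by
    rw [← h.comp_eq_zero_iff]
    refine Eq.congr_left (funext fun i => ?_)
    exact (RingHom.map_mulVec φ B v i).symm
  change _ ↔ φ ∘ v ∈ LinearMap.range (C.map φ).mulVecLin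
  rw [hker, h.comp_mem_range_map_iff]
  simp only [← hBC.linearMap_ker_eq, LinearMap.mem_ker, map_sub, map_smul, sub_eq_zero]
  refine ⟨fun ⟨g, hg⟩ => ?_, fun ⟨z, hz⟩ => ⟨_, hz⟩⟩
  have hAg : A.mulVecLin g = 0 := h.smul_injective <| by
    change x • A.mulVecLin g = x • 0
    rw [← map_smul, ← hg, hAB.apply_apply_eq_zero, smul_zero]
  obtain ⟨z, rfl⟩ := (hAB g).1 hAg
  exact ⟨z, hg⟩

end IsRegularQuotient

end RegularQuotient

section Hyperplane

variable (R : Type*) [CommRing R] (l : ℕ)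

/-- The restriction of polynomials to the hyperplane `x_0 = 0`. -/
noncomputable def restrictHyperplane : MvPolynomial (Fin (l + 1)) R →ₐ[R] MvPolynomial (Fin l) R :=
  aeval (Fin.cons 0 X : Fin (l + 1) → MvPolynomial (Fin l) R)

variable {R l}

@[simp]
theorem restrictHyperplane_X_zero : restrictHyperplane R l (X 0) = 0 := by
  simp [restrictHyperplane]

@[simp]
theorem restrictHyperplane_X_succ (i : Fin l) : restrictHyperplane R l (X i.succ) = X i := by
  simp [restrictHyperplane]

theorem restrictHyperplane_comp_rename_succ :
    (restrictHyperplane R l).comp (rename Fin.succ) = AlgHom.id R _ := by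
  ext i
  simp

theorem ker_restrictHyperplane :
    RingHom.ker (restrictHyperplane R l) = Ideal.span {(X 0 : MvPolynomial (Fin (l + 1)) R)} := by
  refine le_antisymm (fun f hf => ?_) ?_
  · have hmk : (Ideal.Quotient.mkₐ R (Ideal.span {(X 0 : MvPolynomial (Fin (l + 1)) R)})).comp
        ((rename Fin.succ).comp (restrictHyperplane R l)) = Ideal.Quotient.mkₐ R _ := by
      ext i
      cases i using Fin.cases <;> simp
    have hf0 := DFunLike.congr_fun hmk f
    rw [AlgHom.comp_apply, AlgHom.comp_apply, (RingHom.mem_ker).1 hf, map_zero, map_zero] at hf0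
    exact Ideal.Quotient.eq_zero_iff_mem.1 hf0.symm
  · rw [Ideal.span_singleton_le_iff_mem, RingHom.mem_ker, restrictHyperplane_X_zero]

theorem isRegularQuotient_restrictHyperplane :
    IsRegularQuotient (restrictHyperplane R l).toRingHom (X 0) where
  surjective f := ⟨_, DFunLike.congr_fun restrictHyperplane_comp_rename_succ f⟩
  ker_eq := ker_restrictHyperplane
  isRegular := isRegular_X

theorem restrictHyperplane_comp_X_succ_smul {ι : Type*} (i : Fin l)
    (v : ι → MvPolynomial (Fin (l + 1)) R) :
    restrictHyperplane R l ∘ ((X i.succ : MvPolynomial (Fin (l + 1)) R) • v) =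
      (X i : MvPolynomial (Fin l) R) • (restrictHyperplane R l ∘ v) := by
  ext1 k
  simp

theorem isHomogeneous_restrictHyperplane {f : MvPolynomial (Fin (l + 1)) R} {n : ℕ}
    (hf : f.IsHomogeneous n) : (restrictHyperplane R l f).IsHomogeneous n := by
  rw [← one_mul n]
  refine hf.aeval _ fun i => ?_
  cases i using Fin.cases with
  | zero => exact isHomogeneous_zero _ _ _
  | succ i => exact isHomogeneous_X _ _

@[simp]
theorem constantCoeff_restrictHyperplane (f : MvPolynomial (Fin (l + 1)) R) :
    constantCoeff (restrictHyperplane R l f) = constantCoeff f := by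
  have h : (constantCoeff (R := R)).comp (restrictHyperplane R l).toRingHom = constantCoeff := by
    ext i
    · simp
    · cases i using Fin.cases <;> simp
  exact DFunLike.congr_fun h f

end Hyperplane

section GradedVectors

variable {σ R ι κ : Type*} [CommRing R]

theorem homogeneousComponent_mul_of_isHomogeneous {f : MvPolynomial σ R} {m : ℕ}
    (hf : f.IsHomogeneous m) (g : MvPolynomial σ R) (n : ℕ) :
    homogeneousComponent n (f * g) =
      if m ≤ n then f * homogeneousComponent (n - m) g else 0 := by
  have hcomponent (p : MvPolynomial σ R) (i : ℕ) :
      (DirectSum.decompose (homogeneousSubmodule σ R) p i : MvPolynomial σ R) =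
        homogeneousComponent i p :=
    decomposition.decompose'_apply p i
  simpa only [hcomponent] using
    DirectSum.coe_decompose_mul_of_left_mem (homogeneousSubmodule σ R) (b := g) n hf

/-- The component of degree `j` of a vector in the graded free module `⨁_k S(-a k)`. -/
noncomputable def gradedPart (a : ι → ℕ) (j : ℕ) (v : ι → MvPolynomial σ R) :
    ι → MvPolynomial σ R :=
  fun k => if a k ≤ j then homogeneousComponent (j - a k) (v k) else 0

/-- A vector in the graded free module `⨁_k S(-a k)` that is homogeneous of degree `j`. -/
def IsGradedVector (a : ι → ℕ) (j : ℕ) (v : ι → MvPolynomial σ R) : Prop :=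
  ∀ k, v k = 0 ∨ ∃ m, a k + m = j ∧ (v k).IsHomogeneous m

/-- A matrix that defines a map `⨁_c S(-b c) → ⨁_r S(-a r)` homogeneous of degree `0`. -/
def IsGradedMatrix (a : ι → ℕ) (b : κ → ℕ) (d : Matrix ι κ (MvPolynomial σ R)) : Prop :=
  ∀ r c, d r c = 0 ∨ ∃ n, a r + n = b c ∧ (d r c).IsHomogeneous n

/-- A submodule of the graded free module `⨁_k S(-a k)` that contains the homogeneous components
of its elements. -/
def IsGradedSubmodule (a : ι → ℕ) (N : Submodule (MvPolynomial σ R) (ι → MvPolynomial σ R)) :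
    Prop :=
  ∀ j, ∀ v ∈ N, gradedPart a j v ∈ N

variable {a : ι → ℕ} {b : κ → ℕ} {j : ℕ} {v : ι → MvPolynomial σ R}

theorem isGradedVector_gradedPart (a : ι → ℕ) (j : ℕ) (v : ι → MvPolynomial σ R) :
    IsGradedVector a j (gradedPart a j v) := by
  intro k
  unfold gradedPart
  split_ifs with h
  · exact Or.inr ⟨j - a k, by omega, homogeneousComponent_isHomogeneous _ _⟩
  · exact Or.inl rfl

theorem IsGradedVector.gradedPart_eq (h : IsGradedVector a j v) : gradedPart a j v = v := by
  funext k
  obtain hk | ⟨m, hm, hk⟩ := h k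
  · simp [gradedPart, hk]
  · simp [gradedPart, ← hm, homogeneousComponent_eq_self hk]

theorem isGradedVector_zero_iff : IsGradedVector 0 j v ↔ ∀ k, (v k).IsHomogeneous j := by
  refine forall_congr' fun k => ⟨?_, fun h => Or.inr ⟨j, zero_add j, h⟩⟩
  rintro (h | ⟨m, rfl, h⟩)
  · exact h ▸ isHomogeneous_zero _ _ _
  · rwa [Pi.zero_apply, zero_add]

theorem IsGradedVector.smul {f : MvPolynomial σ R} {m : ℕ} (hv : IsGradedVector a j v)
    (hf : f.IsHomogeneous m) : IsGradedVector a (j + m) (f • v) := by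
  intro k
  refine (hv k).imp (fun h => by simp [h]) fun ⟨n, hn, h⟩ => ⟨m + n, by omega, hf.mul h⟩

theorem coeff_gradedPart (m : σ →₀ ℕ) (k : ι) :
    coeff m (gradedPart a j v k) = if a k + m.degree = j then coeff m (v k) else 0 := by
  unfold gradedPart
  split_ifs <;> simp only [coeff_homogeneousComponent, coeff_zero] <;> grind

theorem exists_sum_gradedPart [Finite ι] (a : ι → ℕ) (v : ι → MvPolynomial σ R) :
    ∃ N : ℕ, ∑ j ∈ Finset.range N, gradedPart a j v = v := by
  cases nonempty_fintype ι
  refine ⟨(Finset.univ.sup fun k => a k + (v k).totalDegree) + 1, ?_⟩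
  ext k m
  rw [Finset.sum_apply, coeff_sum]
  simp only [coeff_gradedPart, Finset.sum_ite_eq, Finset.mem_range, ite_eq_left_iff,
    Nat.lt_succ_iff]
  refine fun hk => (coeff_eq_zero_of_totalDegree_lt ?_).symm
  have := Finset.le_sup (f := fun k => a k + (v k).totalDegree) (Finset.mem_univ k)
  simp only [← Finsupp.degree_apply]
  omega

theorem IsGradedMatrix.mulVec_gradedPart [Fintype κ] {d : Matrix ι κ (MvPolynomial σ R)}
    (hd : IsGradedMatrix a b d) (j : ℕ) (v : κ → MvPolynomial σ R) :
    d *ᵥ gradedPart b j v = gradedPart a j (d *ᵥ v) := by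
  have hentry (r : ι) (c : κ) : d r c * gradedPart b j v c =
      if a r ≤ j then homogeneousComponent (j - a r) (d r c * v c) else 0 := by
    unfold gradedPart
    obtain h | ⟨p, hp, h⟩ := hd r c
    · simp [h]
    · rw [homogeneousComponent_mul_of_isHomogeneous h]
      grind
  funext r
  simp only [Matrix.mulVec, dotProduct, hentry]
  unfold gradedPart
  split_ifs
  · exact (map_sum _ _ _).symm
  · exact Finset.sum_const_zero

theorem IsGradedMatrix.exists_isGradedVector_mulVecLin_eq [Fintype κ]
    {d : Matrix ι κ (MvPolynomial σ R)} (hd : IsGradedMatrix a b d) (hv : IsGradedVector a j v)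
    (hmem : v ∈ LinearMap.range d.mulVecLin) :
    ∃ w, IsGradedVector b j w ∧ d.mulVecLin w = v := by
  obtain ⟨w, rfl⟩ := hmem
  exact ⟨gradedPart b j w, isGradedVector_gradedPart b j w,
    (hd.mulVec_gradedPart j w).trans hv.gradedPart_eq⟩

theorem gradedPart_zero (a : ι → ℕ) (j : ℕ) :
    gradedPart a j (0 : ι → MvPolynomial σ R) = 0 :=
  IsGradedVector.gradedPart_eq fun _ => Or.inl rfl

theorem IsGradedMatrix.isGradedSubmodule_ker [Fintype κ] {d : Matrix ι κ (MvPolynomial σ R)}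
    (hd : IsGradedMatrix a b d) : IsGradedSubmodule b (LinearMap.ker d.mulVecLin) := by
  intro j v hv
  rw [LinearMap.mem_ker, Matrix.mulVecLin_apply] at hv ⊢
  rw [hd.mulVec_gradedPart, hv, gradedPart_zero]

theorem IsGradedSubmodule.span_homogeneous [Finite ι]
    {N : Submodule (MvPolynomial σ R) (ι → MvPolynomial σ R)} (hN : IsGradedSubmodule a N) :
    Submodule.span (MvPolynomial σ R) {v | v ∈ N ∧ ∃ j, IsGradedVector a j v} = N := by
  refine le_antisymm (Submodule.span_le.2 fun v hv => hv.1) fun v hv => ?_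
  obtain ⟨n, hn⟩ := exists_sum_gradedPart a v
  rw [← hn]
  exact Submodule.sum_mem _ fun j _ =>
    Submodule.subset_span ⟨hN j v hv, j, isGradedVector_gradedPart a j v⟩

theorem IsGradedSubmodule.exists_isGradedMatrix_range_eq [Finite ι]
    {N : Submodule (MvPolynomial σ R) (ι → MvPolynomial σ R)} (hN : IsGradedSubmodule a N)
    (hfg : N.FG) :
    ∃ (m : ℕ) (b : Fin m → ℕ) (d : Matrix ι (Fin m) (MvPolynomial σ R)),
      IsGradedMatrix a b d ∧ LinearMap.range d.mulVecLin = N := by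
  rw [← hN.span_homogeneous, Submodule.fg_span_iff_fg_span_finset_subset] at hfg
  obtain ⟨T, hTN, hspan⟩ := hfg
  choose! deg hdeg using fun v (hv : v ∈ T) => (hTN hv).2
  let e := T.equivFin.symm
  refine ⟨T.card, fun c => deg (e c), Matrix.of fun r c => (e c : ι → _) r,
    fun r c => hdeg _ (e c).2 r, ?_⟩
  rw [Matrix.range_mulVecLin, ← hN.span_homogeneous, hspan]
  congr 1
  change Set.range (Subtype.val ∘ e) = _
  rw [e.surjective.range_comp, Subtype.range_val_subtype]
  rfl

/-- Minimal homogeneous generators of a submodule `N` of the graded free module `⨁_k S(-a k)`, as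
the columns of a graded matrix. Minimality says that the relations between the columns have no
constant terms. -/
structure MinimalGenerators (a : ι → ℕ)
    (N : Submodule (MvPolynomial σ R) (ι → MvPolynomial σ R)) where
  rank : ℕ
  deg : Fin rank → ℕ
  matrix : Matrix ι (Fin rank) (MvPolynomial σ R)
  isGradedMatrix : IsGradedMatrix a deg matrix
  range_eq : LinearMap.range matrix.mulVecLin = N
  constantCoeff_eq_zero : ∀ v ∈ LinearMap.ker matrix.mulVecLin, ∀ c, constantCoeff (v c) = 0

theorem MinimalGenerators.col_mem {N : Submodule (MvPolynomial σ R) (ι → MvPolynomial σ R)}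
    (g : MinimalGenerators a N) (c : Fin g.rank) : g.matrix.col c ∈ N :=
  g.range_eq.le <| (Matrix.range_mulVecLin _).ge <| Submodule.subset_span ⟨c, rfl⟩

theorem span_range_comp_succAbove {M : Type*} [AddCommGroup M] [Module R M] {n : ℕ}
    {m : Fin (n + 1) → M} {w : Fin (n + 1) → R} (hw : ∑ k, w k • m k = 0) {c : Fin (n + 1)}
    (hc : IsUnit (w c)) :
    Submodule.span R (Set.range (m ∘ c.succAbove)) = Submodule.span R (Set.range m) := by
  refine le_antisymm (Submodule.span_mono (Set.range_comp_subset_range _ _)) ?_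
  rw [Submodule.span_le, Set.range_subset_iff]
  have hother (k : Fin n) : m (c.succAbove k) ∈ Submodule.span R (Set.range (m ∘ c.succAbove)) :=
    Submodule.subset_span ⟨k, rfl⟩
  refine Fin.forall_iff_succAbove c |>.2 ⟨?_, hother⟩
  rw [Fin.sum_univ_succAbove _ c] at hw
  rw [SetLike.mem_coe, ← Submodule.smul_mem_iff_of_isUnit _ hc, eq_neg_of_add_eq_zero_left hw]
  exact Submodule.neg_mem _ (Submodule.sum_mem _ fun k _ => Submodule.smul_mem _ _ (hother k))

theorem IsGradedMatrix.range_submatrix_succAbove {K : Type*} [Field K] {n : ℕ}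
    {b : Fin (n + 1) → ℕ} {d : Matrix ι (Fin (n + 1)) (MvPolynomial σ K)}
    (hd : IsGradedMatrix a b d) {v : Fin (n + 1) → MvPolynomial σ K}
    (hv : v ∈ LinearMap.ker d.mulVecLin) {c : Fin (n + 1)} (hc : constantCoeff (v c) ≠ 0) :
    LinearMap.range (d.submatrix id c.succAbove).mulVecLin = LinearMap.range d.mulVecLin := by
  have hrel : d *ᵥ gradedPart b (b c) v = 0 := hd.isGradedSubmodule_ker (b c) v hv
  have hunit : gradedPart b (b c) v c = C (constantCoeff (v c)) := by
    simp [gradedPart, constantCoeff_eq]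
  rw [Matrix.range_mulVecLin, Matrix.range_mulVecLin]
  refine span_range_comp_succAbove (m := d.col) (w := gradedPart b (b c) v) ?_ ?_
  · rw [← hrel, Matrix.mulVec_eq_sum]
    simp only [op_smul_eq_smul]
    rfl
  · rw [hunit]
    exact (IsUnit.mk0 _ hc).map C

theorem IsGradedSubmodule.nonempty_minimalGenerators {K : Type*} [Field K] [Finite σ] [Finite ι]
    {N : Submodule (MvPolynomial σ K) (ι → MvPolynomial σ K)} (hN : IsGradedSubmodule a N) :
    Nonempty (MinimalGenerators a N) := by
  classical
  have hex := hN.exists_isGradedMatrix_range_eq (IsNoetherian.noetherian N)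
  obtain ⟨b, d, hd, hrange⟩ := Nat.find_spec hex
  have hmin : ∀ m < Nat.find hex, _ := fun m => Nat.find_min hex
  generalize Nat.find hex = n at b d hmin
  refine ⟨⟨n, b, d, hd, hrange, fun v hv c => ?_⟩⟩
  by_contra hc
  obtain _ | n := n
  · exact c.elim0
  · exact hmin n n.lt_succ_self ⟨b ∘ c.succAbove, d.submatrix id c.succAbove, fun r k => hd r _,
      (hd.range_submatrix_succAbove hv hc).trans hrange⟩

end GradedVectors

section Existence

/-- A complex `⋯ → F_2 → F_1 → F_0` of graded free modules that is exact except at `F_0`, that is,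
a resolution of the cokernel of `F_1 → F_0`. In coordinates, `F_i = ⨁_k S(-deg i k)`, and `d i` is
the matrix of `F_{i+1} → F_i`. -/
structure GradedFreeResolution (σ R : Type*) [CommRing R] where
  rank : ℕ → ℕ
  deg : (i : ℕ) → Fin (rank i) → ℕ
  d : (i : ℕ) → Matrix (Fin (rank i)) (Fin (rank (i + 1))) (MvPolynomial σ R)
  isGradedMatrix : ∀ i, IsGradedMatrix (deg i) (deg (i + 1)) (d i)
  exact : ∀ i, Function.Exact (d (i + 1)).mulVecLin (d i).mulVecLin

/-- Minimality of `⋯ → F_2 → F_1` as a resolution of the image of `F_1 → F_0`. Nothing is required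
of the matrix `d 0`. -/
def GradedFreeResolution.IsMinimal {σ R : Type*} [CommRing R] (F : GradedFreeResolution σ R) :
    Prop :=
  ∀ i r c, constantCoeff (F.d (i + 1) r c) = 0

/-- A graded submodule of a graded free module `⨁_k S(-deg k)` of finite rank. -/
structure GradedSubmodule (σ R : Type*) [CommRing R] where
  rank : ℕ
  deg : Fin rank → ℕ
  carrier : Submodule (MvPolynomial σ R) (Fin rank → MvPolynomial σ R)
  isGraded : IsGradedSubmodule deg carrier

namespace GradedSubmodule

/-- A homogeneous ideal, as a graded submodule of `S`. -/
noncomputable def ofIdeal {σ R : Type*} [CommRing R] (I : Ideal (MvPolynomial σ R))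
    (hI : I.IsHomogeneous (homogeneousSubmodule σ R)) : GradedSubmodule σ R where
  rank := 1
  deg := 0
  carrier := Submodule.comap (LinearMap.proj 0) I
  isGraded j v hv := by
    simpa [gradedPart] using homogeneousComponent_mem_of_mem hI hv j

variable {σ K : Type*} [Finite σ] [Field K] (N : GradedSubmodule σ K)

/-- A choice of minimal homogeneous generators. -/
noncomputable def minimalGenerators : MinimalGenerators N.deg N.carrier :=
  N.isGraded.nonempty_minimalGenerators.some

/-- The module of relations between the chosen minimal generators. -/
noncomputable def syzygies : GradedSubmodule σ K where
  rank := N.minimalGenerators.rank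
  deg := N.minimalGenerators.deg
  carrier := LinearMap.ker N.minimalGenerators.matrix.mulVecLin
  isGraded := N.minimalGenerators.isGradedMatrix.isGradedSubmodule_ker

/-- The `i`-th syzygy module, starting with the module itself. -/
noncomputable def iteratedSyzygies : ℕ → GradedSubmodule σ K
  | 0 => N
  | i + 1 => (iteratedSyzygies i).syzygies

/-- The resolution of the quotient of a graded free module by `N` that is obtained by repeatedly
choosing minimal generators. -/
noncomputable def resolution : GradedFreeResolution σ K where
  rank i := (N.iteratedSyzygies i).rank
  deg i := (N.iteratedSyzygies i).deg
  d i := (N.iteratedSyzygies i).minimalGenerators.matrix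
  isGradedMatrix i := (N.iteratedSyzygies i).minimalGenerators.isGradedMatrix
  exact i := LinearMap.exact_iff.2 (N.iteratedSyzygies (i + 1)).minimalGenerators.range_eq.symm

theorem range_d_zero_resolution : LinearMap.range (N.resolution.d 0).mulVecLin = N.carrier :=
  N.minimalGenerators.range_eq

theorem isMinimal_resolution : N.resolution.IsMinimal := by
  intro i r c
  exact (N.iteratedSyzygies i).minimalGenerators.constantCoeff_eq_zero _
    ((N.iteratedSyzygies (i + 1)).minimalGenerators.col_mem c) r

end GradedSubmodule

section RowMatrix

variable {S ι κ : Type*} [CommRing S] [Unique ι] [Fintype κ] (A : Matrix ι κ S)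

theorem mulVecLin_eq_const_linearCombination (v : κ → S) :
    A.mulVecLin v = Function.const ι (Fintype.linearCombination S (A default) v) := by
  ext i
  rw [Unique.eq_default i]
  simp [Matrix.mulVec, dotProduct, Fintype.linearCombination_apply, mul_comm]

theorem exact_mulVecLin_iff_exact_linearCombination {M : Type*} (f : M → κ → S) :
    Function.Exact f A.mulVecLin ↔ Function.Exact f (Fintype.linearCombination S (A default)) := by
  refine forall_congr' fun v => ?_
  rw [mulVecLin_eq_const_linearCombination]
  exact iff_congr (Function.const_injective.eq_iff (b := (0 : S))) Iff.rfl

theorem const_mem_range_mulVecLin_iff (f : S) :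
    Function.const ι f ∈ LinearMap.range A.mulVecLin ↔ f ∈ Ideal.span (Set.range (A default)) := by
  rw [Ideal.span, ← Fintype.range_linearCombination, LinearMap.mem_range, LinearMap.mem_range]
  simp only [mulVecLin_eq_const_linearCombination, Function.const_inj]

end RowMatrix

variable {K : Type*} [Field K] {l : ℕ}

theorem nonempty_minimalGradedFreeResolution (I : Ideal (MvPolynomial (Fin l) K))
    (hI : I.IsHomogeneous (homogeneousSubmodule (Fin l) K)) :
    Nonempty (MinimalGradedFreeResolution I) := by
  let N := GradedSubmodule.ofIdeal I hI
  let F := N.resolution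
  let A : Matrix (Fin 1) (Fin (F.rank 1)) (MvPolynomial (Fin l) K) := F.d 0
  refine ⟨{
    rank i := F.rank (i + 1)
    deg i := F.deg (i + 1)
    gen := A 0
    d i := F.d (i + 1)
    gen_homogeneous k := isGradedVector_zero_iff.1 (fun r => F.isGradedMatrix 0 r k) (0 : Fin 1)
    d_homogeneous i := F.isGradedMatrix (i + 1)
    span_gen := ?_
    exact_zero := (exact_mulVecLin_iff_exact_linearCombination A _).1 (F.exact 0)
    exact_succ i := F.exact (i + 1)
    minimal := N.isMinimal_resolution }⟩
  ext f
  refine (const_mem_range_mulVecLin_iff A f).symm.trans ?_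
  exact iff_of_eq (congrArg (_ ∈ ·) N.range_d_zero_resolution)

/-- The resolution `⋯ → F_1 → F_0 → S` of `S/I`. -/
def MinimalGradedFreeResolution.augmented {I : Ideal (MvPolynomial (Fin l) K)}
    (F : MinimalGradedFreeResolution I) : GradedFreeResolution (Fin l) K where
  rank
    | 0 => 1
    | i + 1 => F.rank i
  deg
    | 0 => 0
    | i + 1 => F.deg i
  d
    | 0 => Matrix.of fun _ : Fin 1 => F.gen
    | i + 1 => F.d i
  isGradedMatrix
    | 0 => fun r c => isGradedVector_zero_iff.2 (fun _ => F.gen_homogeneous c) r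
    | i + 1 => F.d_homogeneous i
  exact
    | 0 => (exact_mulVecLin_iff_exact_linearCombination _ _).2 F.exact_zero
    | i + 1 => F.exact_succ i

theorem MinimalGradedFreeResolution.const_mem_range_augmented {I : Ideal (MvPolynomial (Fin l) K)}
    (F : MinimalGradedFreeResolution I) (f : MvPolynomial (Fin l) K) :
    Function.const (Fin 1) f ∈ LinearMap.range (F.augmented.d 0).mulVecLin ↔ f ∈ I :=
  (const_mem_range_mulVecLin_iff (Matrix.of fun _ : Fin 1 => F.gen) f).trans <|
    iff_of_eq (congrArg (f ∈ ·) F.span_gen)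

end Existence

section Syzygies

variable {R : Type*} [CommRing R] {l : ℕ}

theorem IsGradedVector.restrictHyperplane {ι : Type*} {a : ι → ℕ} {j : ℕ}
    {v : ι → MvPolynomial (Fin (l + 1)) R} (hv : IsGradedVector a j v) :
    IsGradedVector a j (restrictHyperplane R l ∘ v) := fun k =>
  (hv k).imp (fun h => by simp [h]) fun ⟨m, hm, h⟩ => ⟨m, hm, isHomogeneous_restrictHyperplane h⟩

/-- An element of a module over a polynomial ring that represents a nonzero element of the socle of
the quotient by the submodule `p`. -/
def IsSocleRepresentative {σ M : Type*} [AddCommGroup M] [Module (MvPolynomial σ R) M]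
    (p : Submodule (MvPolynomial σ R) M) (u : M) : Prop :=
  u ∉ p ∧ ∀ i, (X i : MvPolynomial σ R) • u ∈ p

namespace GradedFreeResolution

/-- The part `⋯ → F_2 → F_1` of a resolution, restricted to the hyperplane `x_0 = 0`. -/
noncomputable def hyperplaneTail (F : GradedFreeResolution (Fin (l + 1)) R) :
    GradedFreeResolution (Fin l) R where
  rank i := F.rank (i + 1)
  deg i := F.deg (i + 1)
  d i := (F.d (i + 1)).map (restrictHyperplane R l).toRingHom
  isGradedMatrix i r c := IsGradedVector.restrictHyperplane (F.isGradedMatrix (i + 1) · c) r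
  exact i := isRegularQuotient_restrictHyperplane.exact_map (F.exact i) (F.exact (i + 1))

theorem IsMinimal.hyperplaneTail {F : GradedFreeResolution (Fin (l + 1)) R} (hF : F.IsMinimal) :
    F.hyperplaneTail.IsMinimal := fun i r c =>
  (constantCoeff_restrictHyperplane _).trans (hF (i + 1) r c)

theorem IsMinimal.d_succ_eq_zero {σ : Type*} [IsEmpty σ] {F : GradedFreeResolution σ R}
    (hF : F.IsMinimal) (i : ℕ) : F.d (i + 1) = 0 := by
  ext1 r c
  rw [eq_C_of_isEmpty (F.d (i + 1) r c), ← constantCoeff_eq, hF, C_0, Matrix.zero_apply]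

/-- Hilbert's syzygy theorem. -/
theorem IsMinimal.rank_eq_zero [Nontrivial R] {F : GradedFreeResolution (Fin l) R}
    (hF : F.IsMinimal) {i : ℕ} (hi : l + 2 ≤ i) : F.rank i = 0 := by
  induction l generalizing i with
  | zero =>
    obtain ⟨i, rfl⟩ := Nat.exists_eq_add_of_le' hi
    have htop := LinearMap.exact_iff.1 (F.exact (i + 1))
    rw [hF.d_succ_eq_zero, hF.d_succ_eq_zero, Matrix.mulVecLin_zero, Matrix.mulVecLin_zero,
      LinearMap.ker_zero, LinearMap.range_zero] at htop
    have := (Submodule.subsingleton_iff _).1 (subsingleton_of_bot_eq_top htop.symm)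
    by_contra hrank
    have : Nonempty (Fin (F.rank (i + 2))) := ⟨⟨0, Nat.pos_of_ne_zero hrank⟩⟩
    exact false_of_nontrivial_of_subsingleton (Fin (F.rank (i + 2)) → MvPolynomial (Fin 0) R)
  | succ l ih =>
    obtain ⟨i, rfl⟩ := Nat.exists_eq_add_of_le' (Nat.le_of_add_left_le hi)
    exact ih hF.hyperplaneTail (by omega)

theorem exists_isSocleRepresentative_hyperplaneTail (F : GradedFreeResolution (Fin (l + 1)) R)
    {j : ℕ} {u : Fin (F.rank 0) → MvPolynomial (Fin (l + 1)) R} (hu : IsGradedVector (F.deg 0) j u)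
    (hsocle : IsSocleRepresentative (LinearMap.range (F.d 0).mulVecLin) u) :
    ∃ v, IsGradedVector (F.deg 1) (j + 1) v ∧
      IsSocleRepresentative (LinearMap.range (F.hyperplaneTail.d 0).mulVecLin) v := by
  obtain ⟨v, hv, hvu⟩ := (F.isGradedMatrix 0).exists_isGradedVector_mulVecLin_eq
    (hu.smul (isHomogeneous_X R 0)) (hsocle.2 0)
  refine ⟨restrictHyperplane R l ∘ v, hv.restrictHyperplane, ?_, fun i => ?_⟩
  · exact (isRegularQuotient_restrictHyperplane.comp_mem_range_map_iff_of_smul_eq (F.exact 0)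
      hvu).not.2 hsocle.1
  · have hXv : (F.d 0).mulVecLin ((X i.succ : MvPolynomial (Fin (l + 1)) R) • v) =
        (X 0 : MvPolynomial (Fin (l + 1)) R) • (X i.succ : MvPolynomial (Fin (l + 1)) R) • u := by
      rw [map_smul, hvu, smul_comm]
    exact restrictHyperplane_comp_X_succ_smul i v ▸
      (isRegularQuotient_restrictHyperplane.comp_mem_range_map_iff_of_smul_eq (F.exact 0) hXv).2
        (hsocle.2 i.succ)

theorem exists_deg_eq_of_isSocleRepresentative (F : GradedFreeResolution (Fin l) R) {j : ℕ}
    {u : Fin (F.rank 0) → MvPolynomial (Fin l) R} (hu : IsGradedVector (F.deg 0) j u)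
    (hsocle : IsSocleRepresentative (LinearMap.range (F.d 0).mulVecLin) u) :
    ∃ k, F.deg l k = j + l := by
  induction l generalizing j with
  | zero =>
    have hu0 : u ≠ 0 := by
      rintro rfl
      exact hsocle.1 (zero_mem _)
    obtain ⟨k, hk⟩ := Function.ne_iff.1 hu0
    obtain ⟨m, hm, h⟩ := (hu k).resolve_left hk
    obtain rfl := h.inj_right (isHomogeneous_of_isEmpty _ _ (u k)) hk
    exact ⟨k, hm⟩
  | succ l ih =>
    obtain ⟨v, hv, hv_socle⟩ := F.exists_isSocleRepresentative_hyperplaneTail hu hsocle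
    obtain ⟨k, hk⟩ := ih F.hyperplaneTail hv hv_socle
    exact ⟨k, hk.trans (Nat.add_right_comm j 1 l)⟩

end GradedFreeResolution

end Syzygies

section Regularity

variable {K : Type*} [Field K] {l : ℕ}

theorem MinimalGradedFreeResolution.isSocleRepresentative_augmented_iff
    {I : Ideal (MvPolynomial (Fin l) K)} (F : MinimalGradedFreeResolution I)
    (u : MvPolynomial (Fin l) K) :
    IsSocleRepresentative (LinearMap.range (F.augmented.d 0).mulVecLin) (Function.const (Fin 1) u) ↔
      IsSocleRepresentative I u :=
  and_congr (F.const_mem_range_augmented u).not <|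
    forall_congr' fun i => F.const_mem_range_augmented (X i * u)

theorem exists_gradedBetti_ne_zero_iff {I : Ideal (MvPolynomial (Fin l) K)}
    (hI : I.IsHomogeneous (homogeneousSubmodule (Fin l) K)) :
    ∃ F : MinimalGradedFreeResolution I,
      ∀ i j, gradedBetti I i j ≠ 0 ↔ ∃ k, F.deg i k = j := by
  have h := nonempty_minimalGradedFreeResolution I hI
  refine ⟨h.some, fun i j => ?_⟩
  rw [gradedBetti, dif_pos h, Finset.card_ne_zero]
  simp only [Finset.Nonempty, Finset.mem_filter_univ]

theorem finite_regularitySet {I : Ideal (MvPolynomial (Fin l) K)}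
    (hI : I.IsHomogeneous (homogeneousSubmodule (Fin l) K)) : (regularitySet I).Finite := by
  obtain ⟨F, hF⟩ := exists_gradedBetti_ne_zero_iff hI
  refine (Set.finite_range fun p : Σ i : Fin (l + 1), Fin (F.rank i) =>
    ((F.deg p.1 p.2 : ℤ) - (p.1 : ℕ))).subset ?_
  rintro _ ⟨i, j, hij, rfl⟩
  obtain ⟨k, rfl⟩ := (hF i j).1 hij
  have hi : i < l + 1 := by
    by_contra! hi
    have hrank : F.rank i = 0 :=
      GradedFreeResolution.IsMinimal.rank_eq_zero (F := F.augmented) F.minimal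
        (Nat.add_le_add_right hi 1)
    exact k.pos.ne' hrank
  exact ⟨⟨⟨i, hi⟩, k⟩, rfl⟩

theorem nonempty_regularitySet {I : Ideal (MvPolynomial (Fin l) K)}
    (hI : I.IsHomogeneous (homogeneousSubmodule (Fin l) K)) (hne : I ≠ ⊥) :
    (regularitySet I).Nonempty := by
  obtain ⟨F, hF⟩ := exists_gradedBetti_ne_zero_iff hI
  have hgen : Nonempty (Fin (F.rank 0)) := by
    by_contra! hempty
    apply hne
    rw [← F.span_gen, Set.range_eq_empty, Ideal.span_empty]
  exact ⟨_, 0, _, (hF 0 _).2 ⟨hgen.some, rfl⟩, rfl⟩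

theorem isGreatest_regularity {I : Ideal (MvPolynomial (Fin l) K)}
    (hI : I.IsHomogeneous (homogeneousSubmodule (Fin l) K)) (hne : I ≠ ⊥) :
    IsGreatest (regularitySet I) (regularity I) :=
  ⟨Int.csSup_mem (nonempty_regularitySet hI hne) (finite_regularitySet hI).bddAbove,
    fun _ => le_csSup (finite_regularitySet hI).bddAbove⟩

theorem lt_regularity_of_isSocleRepresentative {I : Ideal (MvPolynomial (Fin (l + 1)) K)}
    (hI : I.IsHomogeneous (homogeneousSubmodule (Fin (l + 1)) K)) {j : ℕ}
    {u : MvPolynomial (Fin (l + 1)) K} (hu : u.IsHomogeneous j)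
    (hsocle : IsSocleRepresentative I u) : (j : ℤ) < regularity I := by
  obtain ⟨F, hF⟩ := exists_gradedBetti_ne_zero_iff hI
  obtain ⟨k, hk⟩ := F.augmented.exists_deg_eq_of_isSocleRepresentative
    (isGradedVector_zero_iff.2 fun _ : Fin 1 => hu)
    ((F.isSocleRepresentative_augmented_iff u).2 hsocle)
  refine Int.lt_iff_add_one_le.2 (le_csSup (finite_regularitySet hI).bddAbove
    ⟨l, j + (l + 1), (hF _ _).2 ⟨k, hk⟩, ?_⟩)
  push_cast
  ring

end Regularity

section GeneralLinearForms

/-- The associated primes of `S/I` that do not contain the ideal generated by the variables. -/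
def relevantPrimes {σ R : Type*} [CommRing R] (I : Ideal (MvPolynomial σ R)) :
    Set (Ideal (MvPolynomial σ R)) :=
  {P ∈ associatedPrimes (MvPolynomial σ R) (MvPolynomial σ R ⧸ I) | ∃ i, X i ∉ P}

theorem finite_relevantPrimes {σ R : Type*} [Finite σ] [CommRing R] [IsNoetherianRing R]
    (I : Ideal (MvPolynomial σ R)) : (relevantPrimes I).Finite :=
  (associatedPrimes.finite (MvPolynomial σ R) (MvPolynomial σ R ⧸ I)).subset fun _ hP => hP.1

theorem exists_isHomogeneous_one_notMem {σ K : Type*} [Field K] [Infinite K]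
    {s : Set (Ideal (MvPolynomial σ K))} (hs : s.Finite) (hX : ∀ P ∈ s, ∃ i, X i ∉ P) :
    ∃ f : MvPolynomial σ K, f.IsHomogeneous 1 ∧ ∀ P ∈ s, f ∉ P := by
  classical
  let E := homogeneousSubmodule σ K 1
  let V (P : Ideal (MvPolynomial σ K)) : Subspace K E := (P.restrictScalars K).comap E.subtype
  have hV : ⊤ ∉ hs.toFinset.image V := by
    simp only [Finset.mem_image, hs.mem_toFinset, not_exists, not_and]
    intro P hP hPV
    obtain ⟨i, hi⟩ := hX P hP
    have hmem : (⟨X i, isHomogeneous_X K i⟩ : E) ∈ V P := hPV ▸ Submodule.mem_top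
    exact hi hmem
  obtain ⟨f, hf⟩ := (Set.ne_univ_iff_exists_notMem _).1 (Subspace.biUnion_ne_univ_of_top_notMem hV)
  simp only [Set.mem_iUnion, not_exists] at hf
  exact ⟨f, f.2, fun P hP => hf (V P) (Finset.mem_image_of_mem V (hs.mem_toFinset.2 hP))⟩

theorem exists_colon_smul_mem_associatedPrimes {A M : Type*} [CommRing A] [IsNoetherianRing A]
    [AddCommGroup M] [Module A M] {x : M} (hx : x ≠ 0) :
    ∃ g : A, (⊥ : Submodule A M).colon {g • x} ∈ associatedPrimes A M := by
  let N := Submodule.span A {x}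
  have hx' : (⟨x, Submodule.mem_span_singleton_self x⟩ : N) ≠ 0 :=
    fun h => hx (congrArg Subtype.val h)
  obtain ⟨P, hP, -⟩ := exists_le_isAssociatedPrime_of_isNoetherianRing A _ hx'
  obtain ⟨-, ⟨y, hy⟩, rfl⟩ := isAssociatedPrime_iff.1 hP
  obtain ⟨g, rfl⟩ := Submodule.mem_span_singleton.1 hy
  have hcolon : (⊥ : Submodule A N).colon {⟨g • x, hy⟩} = (⊥ : Submodule A M).colon {g • x} := by
    ext p
    simp only [Submodule.mem_colon_singleton, Submodule.mem_bot, Subtype.ext_iff,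
      Submodule.coe_smul, Submodule.coe_zero]
  rw [hcolon] at hP
  exact ⟨g, hP.map_of_injective N.subtype N.injective_subtype⟩

theorem exists_isSocleRepresentative_mul {σ R : Type*} [Finite σ] [CommRing R] [IsNoetherianRing R]
    {I : Ideal (MvPolynomial σ R)} {f u : MvPolynomial σ R} (hf : ∀ P ∈ relevantPrimes I, f ∉ P)
    (hu : u ∉ I) (hfu : f * u ∈ I) : ∃ g, IsSocleRepresentative I (u * g) := by
  have hu0 : Ideal.Quotient.mk I u ≠ 0 := fun h => hu (Ideal.Quotient.eq_zero_iff_mem.1 h)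
  obtain ⟨g, hg⟩ := exists_colon_smul_mem_associatedPrimes (A := MvPolynomial σ R) hu0
  have hmem (p : MvPolynomial σ R) :
      p ∈ (⊥ : Submodule (MvPolynomial σ R) (MvPolynomial σ R ⧸ I)).colon
        {g • Ideal.Quotient.mk I u} ↔ p * (u * g) ∈ I := by
    rw [Submodule.mem_colon_singleton, Submodule.mem_bot, ← Ideal.Quotient.eq_zero_iff_mem,
      mul_comm u]
    rfl
  refine ⟨g, fun hug => ?_, fun i => ?_⟩
  · refine hg.isPrime.ne_top ((Ideal.eq_top_iff_one _).2 ((hmem 1).2 ?_))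
    rwa [one_mul]
  · by_contra hi
    refine hf _ ⟨hg, i, (hmem (X i)).not.2 hi⟩ ((hmem f).2 ?_)
    rw [← mul_assoc]
    exact I.mul_mem_right g hfu

theorem IsSocleRepresentative.exists_homogeneousComponent {σ R : Type*} [CommRing R]
    {I : Ideal (MvPolynomial σ R)} (hI : I.IsHomogeneous (homogeneousSubmodule σ R))
    {u : MvPolynomial σ R} (hu : IsSocleRepresentative I u) :
    ∃ n, IsSocleRepresentative I (homogeneousComponent n u) := by
  obtain ⟨n, hn⟩ := not_forall.1 ((mem_iff_homogeneousComponent_mem hI u).not.1 hu.1)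
  refine ⟨n, hn, fun i => ?_⟩
  have hcomponent : homogeneousComponent (n + 1) (X i * u) = X i * homogeneousComponent n u := by
    rw [homogeneousComponent_mul_of_isHomogeneous (isHomogeneous_X R i),
      if_pos (Nat.le_add_left 1 n), Nat.add_sub_cancel]
  rw [smul_eq_mul, ← hcomponent]
  exact homogeneousComponent_mem_of_mem hI (hu.2 i) (n + 1)

theorem exists_isHomogeneous_isSocleRepresentative {σ R : Type*} [Finite σ] [CommRing R]
    [IsNoetherianRing R] {I : Ideal (MvPolynomial σ R)}
    (hI : I.IsHomogeneous (homogeneousSubmodule σ R)) {f u : MvPolynomial σ R}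
    (hf : ∀ P ∈ relevantPrimes I, f ∉ P) {i : ℕ} (hu : u.IsHomogeneous i) (huI : u ∉ I)
    (hfu : f * u ∈ I) :
    ∃ j ≥ i, ∃ w : MvPolynomial σ R, w.IsHomogeneous j ∧ IsSocleRepresentative I w := by
  obtain ⟨g, hg⟩ := exists_isSocleRepresentative_mul hf huI hfu
  obtain ⟨j, hj⟩ := hg.exists_homogeneousComponent hI
  refine ⟨j, ?_, _, homogeneousComponent_isHomogeneous j _, hj⟩
  by_contra hij
  rw [homogeneousComponent_mul_of_isHomogeneous hu, if_neg hij] at hj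
  exact hj.1 (zero_mem I)

end GeneralLinearForms

section MulMap

variable {K R : Type*} [Field K] [CommRing R] [Algebra K R] {𝒜 : ℕ → Submodule K R}
  [SetLike.GradedMonoid 𝒜]

theorem mulMap_add_smul (ℓ₀ ℓ₁ : 𝒜 1) (s : K) (i : ℕ) :
    mulMap 𝒜 (ℓ₀ + s • ℓ₁) i = mulMap 𝒜 ℓ₀ i + s • mulMap 𝒜 ℓ₁ i := by
  ext x
  change ((ℓ₀ : R) + s • (ℓ₁ : R)) * x = ℓ₀ * x + s • ((ℓ₁ : R) * x)
  rw [add_mul, smul_mul_assoc]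

theorem eventually_fullRank_mulMap_add_smul [∀ i, FiniteDimensional K (𝒜 i)] {ℓ₀ : 𝒜 1}
    {t : Set ℕ} (ht : t.Finite) (hℓ₀ : ∀ i ∈ t, FullRank (mulMap 𝒜 ℓ₀ i)) (ℓ₁ : 𝒜 1) :
    ∀ᶠ s : K in cofinite, ∀ i ∈ t, FullRank (mulMap 𝒜 (ℓ₀ + s • ℓ₁) i) := by
  simp only [mulMap_add_smul]
  exact (eventually_all_finite ht).2 fun i hi => (hℓ₀ i hi).eventually_add_smul _

end MulMap

section WeakLefschetz

variable {K : Type*} [Field K] {l : ℕ}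

instance finiteDimensional_quotientGrading (I : Ideal (MvPolynomial (Fin l) K)) (i : ℕ) :
    FiniteDimensional K (quotientGrading I i) :=
  Module.Finite.iff_fg.2 ((homogeneousSubmodule_fg (Fin l) K i).map _)

theorem fullRank_mulMap_quotientGrading_fin_zero (I : Ideal (MvPolynomial (Fin 0) K))
    (ℓ : quotientGrading I 1) (i : ℕ) : FullRank (mulMap (quotientGrading I) ℓ i) := by
  refine Or.inr ?_
  rintro ⟨_, u, hu, rfl⟩
  have hu0 : u = 0 := by
    by_contra h
    exact i.succ_ne_zero (IsHomogeneous.inj_right hu (isHomogeneous_of_isEmpty _ _ u) h)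
  subst hu0
  exact ⟨0, Subtype.ext (by simp)⟩

theorem injective_mulMap_of_regularity_le {I : Ideal (MvPolynomial (Fin (l + 1)) K)}
    (hI : I.IsHomogeneous (homogeneousSubmodule (Fin (l + 1)) K))
    {f : MvPolynomial (Fin (l + 1)) K} (hf : ∀ P ∈ relevantPrimes I, f ∉ P)
    {ℓ : quotientGrading I 1} (hℓ : ℓ = Ideal.Quotient.mk I f) {i : ℕ} (hi : regularity I ≤ i) :
    Function.Injective (mulMap (quotientGrading I) ℓ i) := by
  rw [injective_iff_map_eq_zero]
  rintro ⟨_, u, hu, rfl⟩ hker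
  have hfu : f * u ∈ I := by
    rw [← Ideal.Quotient.eq_zero_iff_mem, map_mul, ← hℓ]
    exact congrArg Subtype.val hker
  suffices huI : u ∈ I from Subtype.ext (Ideal.Quotient.eq_zero_iff_mem.2 huI)
  by_contra huI
  obtain ⟨j, hij, w, hw, hsocle⟩ := exists_isHomogeneous_isSocleRepresentative hI hf hu huI hfu
  have := lt_regularity_of_isSocleRepresentative hI hw hsocle
  omega

theorem hasWLP_of_fullRank_lt_regularity [Infinite K] {I : Ideal (MvPolynomial (Fin l) K)}
    (hI : I.IsHomogeneous (homogeneousSubmodule (Fin l) K)) {ℓ₀ : quotientGrading I 1}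
    (h₀ : ∀ i : ℕ, (i : ℤ) < regularity I → FullRank (mulMap (quotientGrading I) ℓ₀ i)) :
    HasWLP (quotientGrading I) := by
  obtain _ | l := l
  · exact ⟨ℓ₀, fullRank_mulMap_quotientGrading_fin_zero I ℓ₀⟩
  obtain ⟨f₀, -, hf₀⟩ := ℓ₀.2
  obtain ⟨f₁, hf₁, hrel⟩ :=
    exists_isHomogeneous_one_notMem (finite_relevantPrimes I) fun P hP => hP.2
  let ℓ₁ : quotientGrading I 1 := ⟨Ideal.Quotient.mk I f₁, f₁, hf₁, rfl⟩
  have hlow : {i : ℕ | (i : ℤ) < regularity I}.Finite :=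
    (Set.finite_Iio (regularity I).toNat).subset fun _ => Int.lt_toNat.2
  have hfull := eventually_fullRank_mulMap_add_smul hlow h₀ ℓ₁
  have havoid : ∀ᶠ s : K in cofinite, ∀ P ∈ relevantPrimes I, f₀ + s • f₁ ∉ P :=
    (eventually_all_finite (finite_relevantPrimes I)).2 fun P hP =>
      eventually_add_smul_notMem (p := P.restrictScalars K) f₀ (hrel P hP)
  obtain ⟨s, hs_full, hs_avoid⟩ := (hfull.and havoid).exists
  have hℓ : ((ℓ₀ + s • ℓ₁ : quotientGrading I 1) : MvPolynomial (Fin (l + 1)) K ⧸ I) =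
      Ideal.Quotient.mk I (f₀ + s • f₁) :=
    congrArg (· + s • Ideal.Quotient.mk I f₁) hf₀.symm
  refine ⟨ℓ₀ + s • ℓ₁, fun i => (lt_or_ge (i : ℤ) (regularity I)).elim (hs_full i) fun hi => ?_⟩
  exact Or.inl (injective_mulMap_of_regularity_le hI hs_avoid hℓ hi)

end WeakLefschetz

end Lefschetz

theorem mainTheorem2_general {K : Type*} [Field K] [Infinite K] {l : ℕ}
    (I : Ideal (MvPolynomial (Fin l) K))
    (hI : I.IsHomogeneous (MvPolynomial.homogeneousSubmodule (Fin l) K)) :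
    (I ≠ ⊥ → IsGreatest (Lefschetz.regularitySet I) (Lefschetz.regularity I)) ∧
    (Lefschetz.HasWLP (Lefschetz.quotientGrading I) ↔
      ∃ ℓ : Lefschetz.quotientGrading I 1, ∀ i : ℕ,
        (i : ℤ) ≤ Lefschetz.regularity I - 1 →
          Lefschetz.FullRank (Lefschetz.mulMap (Lefschetz.quotientGrading I) ℓ i)) := by
  refine ⟨Lefschetz.isGreatest_regularity hI, ?_, ?_⟩
  · rintro ⟨ℓ, hℓ⟩
    exact ⟨ℓ, fun i _ => hℓ i⟩
  · rintro ⟨ℓ, hℓ⟩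
    exact Lefschetz.hasWLP_of_fullRank_lt_regularity hI fun i hi => hℓ i (Int.le_sub_one_of_lt hi)

theorem mainTheorem2 {K : Type*} [Field K] [CharZero K] {l : ℕ}
    (I : Ideal (MvPolynomial (Fin l) K))
    (hI : I.IsHomogeneous (MvPolynomial.homogeneousSubmodule (Fin l) K)) :
    (I ≠ ⊥ → IsGreatest (Lefschetz.regularitySet I) (Lefschetz.regularity I)) ∧
    (Lefschetz.HasWLP (Lefschetz.quotientGrading I) ↔
      ∃ ℓ : Lefschetz.quotientGrading I 1, ∀ i : ℕ,
        (i : ℤ) ≤ Lefschetz.regularity I - 1 →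
          Lefschetz.FullRank (Lefschetz.mulMap (Lefschetz.quotientGrading I) ℓ i)) := by
  have : Infinite K := CharZero.infinite K
  exact mainTheorem2_general I hI
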